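/- Let $X$ and $Y$ be compact metric absolute neighbourhood retracts, i.e. compact metric spaces that are neighbourhood retracts in every metrizable space containing them as a closed subspace, and let $f\colon X\to Y$ be a (Hurewicz) fibration. Let $X^I$ be the space of continuous paths $\gamma\colon[0,1]\to X$ with the compact-open topology, and let $\pi_f\colon X^I\to X\times Y$ be the map $\pi_f(\gamma)=(\gamma(0),f(\gamma(1)))$. A continuous partial section of $\pi_f$ over a subset $A\subseteq X\times Y$ is a continuous map $s\colon A\to X^I$ with $\pi_f(s(a))=a$ for all $a\in A$. The topological complexity $\mathrm{TC}(f)$ is the minimal integer $n\ge 0$ for which there are open subsets $$\emptyset=U_0\subseteq U_1\subseteq\cdots\subseteq U_n=X\times Y$$ such that $\pi_f$ admits a continuous partial section over each difference $U_i\setminus U_{i-1}$, $i=1,\ldots,n$ (and $\mathrm{TC}(f)=\infty$ if there is no such $n$). Then $\mathrm{TC}(f)$ is equal to the minimal integer $n\ge 0$ for which there is a cover $$X\times Y=A_1\cup\cdots\cup A_n$$ by arbitrary (not necessarily open) subsets such that $\pi_f$ admits a continuous partial section over each $A_i$ (with the value $\infty$ if there is no such $n$). -/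

import Mathlib

open Set Topology unitInterval

universe u v

namespace FibTC

/-- A metric absolute neighbourhood retract: a metrizable space that is a neighbourhood retract
in every metrizable space containing it as a closed subspace. -/
structure IsMetricANR (X : Type u) [TopologicalSpace X] : Prop where
  metrizable : TopologicalSpace.MetrizableSpace X
  exists_retraction : ∀ (Z : Type u) [TopologicalSpace Z] [TopologicalSpace.MetrizableSpace Z]
    (e : X → Z), IsClosedEmbedding e →
      ∃ (U : Set Z) (_ : IsOpen U) (hU : ∀ x, e x ∈ U) (r : C(U, X)), ∀ x, r ⟨e x, hU x⟩ = x

/-- Hurewicz fibration: the homotopy lifting property with respect to all spaces. (The universal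
test space, the pullback of `f` along the evaluation at `0` on paths in `Y`, lives in the universe
used here.) -/
def IsFibration {X : Type u} {Y : Type v} [TopologicalSpace X] [TopologicalSpace Y]
    (f : C(X, Y)) : Prop :=
  ∀ (A : Type (max u v)) [TopologicalSpace A] (h : C(A, X)) (H : C(A × I, Y)),
    (∀ a, H (a, 0) = f (h a)) →
      ∃ K : C(A × I, X), (∀ a, K (a, 0) = h a) ∧ ∀ z, f (K z) = H z

/-- `p` admits a continuous partial section over the subspace `A` of the base. -/
def HasPartialSection {E : Type u} {B : Type v} [TopologicalSpace E] [TopologicalSpace B]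
    (p : C(E, B)) (A : Set B) : Prop :=
  ∃ s : C(A, E), ∀ a : A, p (s a) = a

/-- There are open sets `∅ = U 0 ⊆ U 1 ⊆ ⋯ ⊆ U n = B` such that `p` admits a continuous partial
section over each difference `U (i + 1) \ U i`. -/
def HasSectionalFiltration {E : Type u} {B : Type v} [TopologicalSpace E] [TopologicalSpace B]
    (p : C(E, B)) (n : ℕ) : Prop :=
  ∃ U : Fin (n + 1) → Set B, Monotone U ∧ (∀ i, IsOpen (U i)) ∧ U 0 = ∅ ∧ U (Fin.last n) = univ ∧
    ∀ i : Fin n, HasPartialSection p (U i.succ \ U i.castSucc)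

/-- The sectional number of `p`; it is `⊤` when no finite filtration exists. -/
noncomputable def sec {E : Type u} {B : Type v} [TopologicalSpace E] [TopologicalSpace B]
    (p : C(E, B)) : ℕ∞ :=
  ⨅ (n : ℕ) (_ : HasSectionalFiltration p n), (n : ℕ∞)

/-- The map `γ ↦ (γ 0, f (γ 1))` from the path space of `X` (with the compact-open topology)
to `X × Y`. -/
def piMap {X : Type u} {Y : Type v} [TopologicalSpace X] [TopologicalSpace Y] (f : C(X, Y)) :
    C(C(I, X), X × Y) where
  toFun γ := (γ 0, f (γ 1))
  continuous_toFun := by fun_prop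

/-- The topological complexity of the map `f`. -/
noncomputable def TC {X : Type u} {Y : Type v} [TopologicalSpace X] [TopologicalSpace Y]
    (f : C(X, Y)) : ℕ∞ :=
  sec (piMap f)

end FibTC

/-!
The essential point is that a partial section of `piMap f` over an *arbitrary* subset
`A ⊆ X × Y` gives one over an open neighbourhood of `A`; the sets of a cover can then be replaced
by open sets, and their successive unions form the required filtration. Conversely, the differences
of a filtration cover `X × Y`.

To pass to an open neighbourhood, `X` is embedded isometrically in the Banach space `C(X, ℝ)`, so
that a partial section becomes a map from `A` to the normed space `C(I, C(X, ℝ))`. Averaging its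
values by a partition of unity gives a map `τ` on an open neighbourhood `V` of `A` which does not
extend the section, but stays close to its nearby values (`exists_isOpen_continuousMap_near`). As
`X` is a compact ANR, the paths `τ b` can be retracted into `X`
(`IsMetricANR.exists_retraction_near`). This yields a family of paths in `X`, parametrized by
`b = (x, y) ∈ V`, that start near `x` and end at points whose image under `f` is near `y`. Both
errors are then removed: in a compact ANR uniformly close maps are homotopic
(`IsMetricANR.exists_homotopic_of_dist_lt`), which provides a short path from `x` to the initial
point, and a short path in `Y` from the image of the end point to `y`. The latter is lifted to `X`
by the fibration property, and the three families of paths are concatenated.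
-/

namespace FibTC

/-! ### Approximate extension of maps into normed spaces -/

/-- A continuous map from an arbitrary subset of a metric space to a normed space has approximate
extensions to open neighbourhoods of that subset. -/
theorem exists_isOpen_continuousMap_near {B N : Type*} [MetricSpace B] [NormedAddCommGroup N]
    [NormedSpace ℝ N] {A : Set B} (s : C(A, N)) {η : ℝ} (hη : 0 < η) :
    ∃ V : Set B, IsOpen V ∧ A ⊆ V ∧ ∃ τ : C(V, N), ∀ b : V, ∃ a : A,
      dist (a : B) b < η ∧ dist (τ b) (s a) < η := by
  have hη2 : 0 < η / 2 := half_pos hη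
  have hmod : ∀ a : A, ∃ δ > 0, ∀ a' : A, dist a' a < δ → dist (s a') (s a) < η / 2 :=
    fun a ↦ Metric.continuous_iff.1 s.continuous a (η / 2) hη2
  choose δ₀ hδ₀ hδs using hmod
  let δ : A → ℝ := fun a ↦ min (δ₀ a) η
  have hδ : ∀ a, 0 < δ a := fun a ↦ lt_min (hδ₀ a) hη
  let V : Set B := ⋃ a : A, Metric.ball (a : B) (δ a / 2)
  let S : V → Set A := fun b ↦ {a | dist (b : B) a < δ a / 2}
  -- Two points of `S b` have distance less than the larger of their two moduli of continuity.
  have hS : ∀ b, ∀ a ∈ S b, ∀ a' ∈ S b, dist (s a') (s a) < η / 2 := by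
    intro b a ha a' ha'
    have h1 : dist (b : B) a < δ a / 2 := ha
    have h2 : dist (b : B) a' < δ a' / 2 := ha'
    have h3 : dist a a' ≤ dist (b : B) a + dist (b : B) a' :=
      dist_triangle_left (a : B) (a' : B) (b : B)
    rcases le_total (δ a) (δ a') with h | h
    · rw [dist_comm]
      exact hδs a' a (lt_of_lt_of_le (by linarith) (min_le_left _ η))
    · refine hδs a a' (lt_of_lt_of_le ?_ (min_le_left _ η))
      rw [dist_comm]
      change dist a a' < δ a
      linarith
  obtain ⟨τ, hτ⟩ := exists_continuous_forall_mem_convex_of_local_const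
    (t := fun b : V ↦ convexHull ℝ (s '' S b)) (fun b ↦ convex_convexHull ℝ _) (by
      intro b
      obtain ⟨a, ha⟩ := mem_iUnion.1 b.2
      refine ⟨s a, ?_⟩
      have hopen : IsOpen {b' : V | dist (b' : B) a < δ a / 2} :=
        isOpen_lt (by fun_prop) continuous_const
      filter_upwards [hopen.mem_nhds ha] with b' hb'
      exact subset_convexHull ℝ _ (mem_image_of_mem s hb'))
  refine ⟨V, isOpen_iUnion fun a ↦ Metric.isOpen_ball, fun a ha ↦ mem_iUnion.2
    ⟨⟨a, ha⟩, Metric.mem_ball_self (half_pos (hδ _))⟩, τ, fun b ↦ ?_⟩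
  obtain ⟨a, ha⟩ := mem_iUnion.1 b.2
  have haS : dist (b : B) a < δ a / 2 := ha
  refine ⟨a, ?_, ?_⟩
  · rw [dist_comm]
    have : δ a ≤ η := min_le_right _ _
    linarith [hδ a]
  · have hsub : convexHull ℝ (s '' S b) ⊆ Metric.ball (s a) (η / 2) := by
      refine convexHull_min ?_ (convex_ball _ _)
      rintro _ ⟨a', ha', rfl⟩
      exact hS b a ha a' ha'
    have := Metric.mem_ball.1 (hsub (hτ b))
    linarith

/-! ### Compact metric absolute neighbourhood retracts -/

/-- The embedding of a compact metric space `X` in the Banach space `C(X, ℝ)` that maps a point to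
the distance from it. -/
noncomputable def distEmbedding (X : Type*) [MetricSpace X] [CompactSpace X] : C(X, C(X, ℝ)) :=
  ContinuousMap.curry ⟨fun p : X × X ↦ dist p.1 p.2, by fun_prop⟩

theorem distEmbedding_isometry (X : Type*) [MetricSpace X] [CompactSpace X] :
    Isometry (distEmbedding X) := by
  refine Isometry.of_dist_eq fun x x' ↦ le_antisymm ?_ ?_
  · exact (ContinuousMap.dist_le dist_nonneg).2 fun y ↦ abs_dist_sub_le x x' y
  · have h := ContinuousMap.dist_apply_le_dist (f := distEmbedding X x)
      (g := distEmbedding X x') x'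
    simpa [distEmbedding, Real.dist_eq] using h

/-- A compact metric ANR is a retract of an open set of `C(X, ℝ)`, and by compactness the
retraction moves the points of a small uniform neighbourhood of `X` only a little. -/
theorem IsMetricANR.exists_retraction_near {X : Type u} [MetricSpace X] [CompactSpace X]
    (hX : IsMetricANR X) :
    ∃ (U : Set C(X, ℝ)) (r : C(U, X)) (hU : ∀ x, distEmbedding X x ∈ U),
      (∀ x, r ⟨distEmbedding X x, hU x⟩ = x) ∧
      ∀ ε > 0, ∃ η > 0, ∀ x z, dist z (distEmbedding X x) < η →
        ∃ hz : z ∈ U, dist (r ⟨z, hz⟩) x < ε := by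
  obtain ⟨U, hUo, hU, r, hr⟩ := hX.exists_retraction C(X, ℝ) (distEmbedding X)
    (distEmbedding_isometry X).isClosedEmbedding
  refine ⟨U, r, hU, hr, fun ε hε ↦ ?_⟩
  let O : Set (C(X, ℝ) × X) := {p | ∃ hz : p.1 ∈ U, dist (r ⟨p.1, hz⟩) p.2 < ε}
  have hO : IsOpen O := by
    have hW : IsOpen {q : U × X | dist (r q.1) q.2 < ε} :=
      isOpen_lt (by fun_prop) continuous_const
    have hemb : IsOpenEmbedding (Prod.map (Subtype.val : U → C(X, ℝ)) (id : X → X)) :=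
      hUo.isOpenEmbedding_subtypeVal.prodMap .id
    convert hemb.isOpenMap _ hW using 1
    ext ⟨z, x⟩
    simp [O]
  have hK : IsCompact (range fun x ↦ (distEmbedding X x, x)) :=
    isCompact_range (by fun_prop)
  obtain ⟨η, hη, hsub⟩ := hK.exists_thickening_subset_open hO (by
    rintro _ ⟨x, rfl⟩
    exact ⟨hU x, by simpa [hr x] using hε⟩)
  refine ⟨η, hη, fun x z hz ↦ ?_⟩
  have : (z, x) ∈ O := hsub (Metric.mem_thickening_iff.2 ⟨_, mem_range_self x, by
    simpa [Prod.dist_eq, hη] using hz⟩)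
  exact this

/-- Uniformly close maps into a compact metric ANR are homotopic: the straight-line homotopy in
`C(X, ℝ)` can be retracted into `X`. -/
theorem IsMetricANR.exists_homotopic_of_dist_lt {X : Type u} [MetricSpace X] [CompactSpace X]
    (hX : IsMetricANR X) :
    ∃ ε > 0, ∀ {V : Type*} [TopologicalSpace V] (g₀ g₁ : C(V, X)),
      (∀ v, dist (g₀ v) (g₁ v) < ε) → g₀.Homotopic g₁ := by
  obtain ⟨U, r, hU, hr, hnear⟩ := hX.exists_retraction_near
  obtain ⟨η, hη, hηU⟩ := hnear 1 one_pos
  refine ⟨η, hη, fun {V} _ g₀ g₁ hg ↦ ?_⟩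
  let L : C(I × V, C(X, ℝ)) :=
    ⟨fun p ↦ AffineMap.lineMap (distEmbedding X (g₀ p.2)) (distEmbedding X (g₁ p.2)) (p.1 : ℝ), by
      simp only [AffineMap.lineMap_apply_module]
      fun_prop⟩
  have hL : ∀ p, L p ∈ U := by
    rintro ⟨t, v⟩
    refine (hηU (g₀ v) _ ?_).1
    change dist (AffineMap.lineMap _ _ (t : ℝ)) _ < η
    rw [dist_lineMap_left, (distEmbedding_isometry X).dist_eq, Real.norm_of_nonneg t.2.1]
    exact (mul_le_of_le_one_left dist_nonneg t.2.2).trans_lt (hg v)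
  refine ⟨⟨r.comp ⟨fun p ↦ ⟨L p, hL p⟩, by fun_prop⟩, fun v ↦ ?_, fun v ↦ ?_⟩⟩
  · have : (⟨L (0, v), hL (0, v)⟩ : U) = ⟨_, hU (g₀ v)⟩ := Subtype.ext (by simp [L])
    simp [this, hr]
  · have : (⟨L (1, v), hL (1, v)⟩ : U) = ⟨_, hU (g₁ v)⟩ := Subtype.ext (by simp [L])
    simp [this, hr]

/-! ### Partial sections over open neighbourhoods -/

theorem HasPartialSection.mono {E : Type u} {B : Type v} [TopologicalSpace E] [TopologicalSpace B]
    {p : C(E, B)} {A A' : Set B} (h : HasPartialSection p A') (hA : A ⊆ A') :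
    HasPartialSection p A := by
  obtain ⟨s, hs⟩ := h
  exact ⟨s.comp ⟨inclusion hA, continuous_inclusion hA⟩, fun a ↦ hs (inclusion hA a)⟩

/-- A homotopy on `V` from the first projection to a map `g` with `f ∘ g` the second projection
becomes a section of `piMap f` over `V` by currying. -/
theorem hasPartialSection_piMap_of_homotopic {X : Type u} {Y : Type v} [TopologicalSpace X]
    [TopologicalSpace Y] {f : C(X, Y)} {V : Set (X × Y)} {p g : C(V, X)} (hpg : p.Homotopic g)
    (hp : ∀ b : V, p b = (b : X × Y).1) (hg : ∀ b : V, f (g b) = (b : X × Y).2) :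
    HasPartialSection (piMap f) V := by
  obtain ⟨F⟩ := hpg
  refine ⟨(F.toContinuousMap.comp .prodSwap).curry, fun b ↦ Prod.ext ?_ ?_⟩
  · simp [piMap, hp]
  · simp [piMap, hg]

/-- A partial section of `piMap f` over an arbitrary set yields one over an open neighbourhood; in
general it does not extend the given one. -/
theorem HasPartialSection.exists_isOpen {X : Type u} {Y : Type v} [MetricSpace X] [CompactSpace X]
    [MetricSpace Y] [CompactSpace Y] (hX : IsMetricANR X) (hY : IsMetricANR Y)
    {f : C(X, Y)} (hf : IsFibration f) {A : Set (X × Y)} (hA : HasPartialSection (piMap f) A) :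
    ∃ V, IsOpen V ∧ A ⊆ V ∧ HasPartialSection (piMap f) V := by
  obtain ⟨s, hs⟩ := hA
  have hs0 : ∀ a : A, s a 0 = (a : X × Y).1 := fun a ↦ congrArg Prod.fst (hs a)
  have hs1 : ∀ a : A, f (s a 1) = (a : X × Y).2 := fun a ↦ congrArg Prod.snd (hs a)
  obtain ⟨εX, hεX, homX⟩ := hX.exists_homotopic_of_dist_lt
  obtain ⟨εY, hεY, homY⟩ := hY.exists_homotopic_of_dist_lt
  obtain ⟨ε₁, hε₁, hfε⟩ := Metric.uniformContinuous_iff.1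
    (CompactSpace.uniformContinuous_of_continuous f.continuous) (εY / 2) (half_pos hεY)
  obtain ⟨U, r, -, -, hnear⟩ := hX.exists_retraction_near
  obtain ⟨η₁, hη₁, hηU⟩ := hnear (min (εX / 2) ε₁) (lt_min (half_pos hεX) hε₁)
  obtain ⟨V, hVo, hAV, τ, hτ⟩ := exists_isOpen_continuousMap_near
    (N := C(I, C(X, ℝ)))
    ((⟨fun γ ↦ (distEmbedding X).comp γ, by fun_prop⟩ : C(C(I, X), C(I, C(X, ℝ)))).comp s)
    (lt_min hη₁ (lt_min (half_pos hεX) (half_pos hεY)))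
  have hτ' : ∀ b : V, ∃ a : A, dist (a : X × Y) b < εX / 2 ∧ dist (a : X × Y) b < εY / 2 ∧
      ∀ t, dist (τ b t) (distEmbedding X (s a t)) < η₁ := by
    intro b
    obtain ⟨a, hab, hsa⟩ := hτ b
    simp only [lt_min_iff] at hab hsa
    exact ⟨a, hab.2.1, hab.2.2, fun t ↦ (ContinuousMap.dist_apply_le_dist t).trans_lt hsa.1⟩
  have hτU : ∀ p : I × V, τ p.2 p.1 ∈ U := fun p ↦
    let ⟨_, _, _, h⟩ := hτ' p.2
    (hηU _ _ (h p.1)).1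
  -- The family of paths in `X` obtained by retracting the paths `τ b`.
  let G : C(I × V, X) := r.comp ⟨fun p ↦ ⟨τ p.2 p.1, hτU p⟩, by fun_prop⟩
  have hG : ∀ b : V, ∃ a : A, dist (a : X × Y) b < εX / 2 ∧ dist (a : X × Y) b < εY / 2 ∧
      ∀ t, dist (G (t, b)) (s a t) < min (εX / 2) ε₁ := by
    intro b
    obtain ⟨a, h1, h2, h⟩ := hτ' b
    exact ⟨a, h1, h2, fun t ↦ (hηU _ _ (h t)).2⟩
  let G₀ : C(V, X) := ⟨fun b ↦ G (0, b), by fun_prop⟩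
  let G₁ : C(V, X) := ⟨fun b ↦ G (1, b), by fun_prop⟩
  let p : C(V, X) := ⟨fun b ↦ (b : X × Y).1, by fun_prop⟩
  let q : C(V, Y) := ⟨fun b ↦ (b : X × Y).2, by fun_prop⟩
  have hpG : p.Homotopic G₀ := by
    refine homX p G₀ fun b ↦ ?_
    obtain ⟨a, h1, -, h⟩ := hG b
    have h3 := (h 0).trans_le (min_le_left _ _)
    rw [hs0] at h3
    have h4 : dist (a : X × Y).1 (b : X × Y).1 ≤ dist (a : X × Y) b := le_max_left _ _
    have h5 := dist_triangle (G (0, b)) (a : X × Y).1 (b : X × Y).1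
    rw [dist_comm]
    change dist (G (0, b)) (b : X × Y).1 < εX
    linarith
  have hGG : G₀.Homotopic G₁ := ⟨⟨G, fun _ ↦ rfl, fun _ ↦ rfl⟩⟩
  have hGq : (f.comp G₁).Homotopic q := by
    refine homY _ _ fun b ↦ ?_
    obtain ⟨a, -, h2, h⟩ := hG b
    have h3 := hfε ((h 1).trans_le (min_le_right _ _))
    rw [hs1] at h3
    have h4 : dist (a : X × Y).2 (b : X × Y).2 ≤ dist (a : X × Y) b := le_max_right _ _
    have h5 := dist_triangle (f (G (1, b))) (a : X × Y).2 (b : X × Y).2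
    change dist (f (G (1, b))) (b : X × Y).2 < εY
    linarith
  obtain ⟨H⟩ := hGq
  obtain ⟨K, hK0, hK⟩ := hf V G₁ (H.toContinuousMap.comp .prodSwap) fun b ↦ by simp
  have hGK : G₁.Homotopic ⟨fun b ↦ K (b, 1), by fun_prop⟩ :=
    ⟨⟨K.comp .prodSwap, fun b ↦ hK0 b, fun _ ↦ rfl⟩⟩
  refine ⟨V, hVo, hAV, hasPartialSection_piMap_of_homotopic ((hpG.trans hGG).trans hGK)
    (fun _ ↦ rfl) fun b ↦ ?_⟩
  exact (hK (b, 1)).trans (H.apply_one b)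

/-! ### Filtrations and covers -/

theorem HasSectionalFiltration.exists_cover {E : Type u} {B : Type v} [TopologicalSpace E]
    [TopologicalSpace B] {p : C(E, B)} {n : ℕ} (h : HasSectionalFiltration p n) :
    ∃ A : Fin n → Set B, (⋃ i, A i) = univ ∧ ∀ i, HasPartialSection p (A i) := by
  obtain ⟨U, -, -, h0, h1, hs⟩ := h
  refine ⟨fun i ↦ U i.succ \ U i.castSucc, eq_univ_of_forall fun b ↦ ?_, hs⟩
  by_contra hb
  simp only [mem_iUnion, mem_sdiff, not_exists, not_and, not_not] at hb
  have key : ∀ i : Fin (n + 1), b ∉ U i := by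
    intro i
    induction i using Fin.induction with
    | zero => simp [h0]
    | succ i ih => exact fun h ↦ ih (hb i h)
  exact key (Fin.last n) (h1 ▸ mem_univ b)

/-- The unions of the initial segments of an open cover form a filtration, each difference of which
lies in a single member of the cover. -/
theorem HasSectionalFiltration.of_isOpen_cover {E : Type u} {B : Type v} [TopologicalSpace E]
    [TopologicalSpace B] {p : C(E, B)} {n : ℕ} {V : Fin n → Set B} (hV : ∀ i, IsOpen (V i))
    (hcov : (⋃ i, V i) = univ) (hs : ∀ i, HasPartialSection p (V i)) :
    HasSectionalFiltration p n := by
  refine ⟨fun i ↦ ⋃ (j : Fin n) (_ : j.castSucc < i), V j, fun i i' h ↦ ?_, fun i ↦ ?_, ?_, ?_,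
    fun i ↦ (hs i).mono ?_⟩
  · exact iUnion_mono fun j ↦ iUnion_mono' fun hj ↦ ⟨hj.trans_le h, subset_rfl⟩
  · exact isOpen_iUnion fun j ↦ isOpen_iUnion fun _ ↦ hV j
  · simp
  · simpa [Fin.castSucc_lt_last] using hcov
  · rintro b ⟨hb, hb'⟩
    simp only [mem_iUnion, exists_prop, not_exists, not_and] at hb hb'
    obtain ⟨j, hj, hbj⟩ := hb
    have hji : j = i := by
      refine le_antisymm (Fin.castSucc_lt_succ_iff.1 hj) (not_lt.1 fun hlt ↦ ?_)
      exact hb' j (Fin.castSucc_lt_castSucc_iff.2 hlt) hbj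
    exact hji ▸ hbj

end FibTC

theorem mainTheorem9 {X : Type u} {Y : Type v} [MetricSpace X] [CompactSpace X]
    [MetricSpace Y] [CompactSpace Y] (hX : FibTC.IsMetricANR X) (hY : FibTC.IsMetricANR Y)
    (f : C(X, Y)) (hf : FibTC.IsFibration f) :
    FibTC.TC f =
      ⨅ (n : ℕ) (_ : ∃ A : Fin n → Set (X × Y), (⋃ i, A i) = Set.univ ∧
        ∀ i, FibTC.HasPartialSection (FibTC.piMap f) (A i)), (n : ℕ∞) := by
  refine iInf_congr fun n ↦ iInf_congr_Prop ⟨fun h ↦ h.exists_cover, ?_⟩ fun _ ↦ rfl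
  rintro ⟨A, hA, hs⟩
  choose V hVo hAV hV using fun i ↦ (hs i).exists_isOpen hX hY hf
  exact .of_isOpen_cover hVo (univ_subset_iff.1 (hA ▸ iUnion_mono hAV)) hV
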